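/- Let $n\ge 0$. An $n$-bit (mixed polarity multiple-control Toffoli) gate $\mathbf G[P,N,q]$ is given by disjoint sets $P,N\subseteq\{q_1,\dots,q_n\}$ and a bit $q\notin P\cup N$; it flips $q$ iff all bits of $P$ are $1$ and all bits of $N$ are $0$. An $n$-bit reversible circuit is a finite (possibly empty) sequence of such gates, the leftmost executed first; $\mathrm{CNOT}[p,q]=\mathbf G[\{p\},\emptyset,q]$ and $\epsilon$ is the empty circuit. Two circuits $\mathbf A,\mathbf B$ are equivalent, $\mathbf A\equiv\mathbf B$, if they compute the same function on $\{0,1\}^n$. Let $\mathcal{RC}$ consist of the following rules (for all gates as indicated, on the $n$ given bits): 1. $AA\equiv\epsilon$ for every gate $A$. 2. $A_0A_1\equiv A$ if $A_0=\mathbf G[P,N\cup\{p\},q]$, $A_1=\mathbf G[P\cup\{p\},N,q]$, $A=\mathbf G[P,N,q]$. 3. $AB\equiv BA$ if $A=\mathbf G[P_1,N_1,p]$, $B=\mathbf G[P_2,N_2,q]$ and $P_1\cap N_2\ne\emptyset$ or $P_2\cap N_1\neq\emptyset$. 4. $ABA\,C_1\equiv C_2\,ABA$ if $A=\mathrm{CNOT}[p,q]$,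 $B=\mathrm{CNOT}[q,p]$, $C_1=\mathbf G[P\cup P_1,N\cup N_1,p]$, $C_2=\mathbf G[P\cup P_2,N\cup N_2,q]$, where either $P_1=\{q\}$, $P_2=\{p\}$, $N_1=N_2=\emptyset$, or $N_1=\{q\}$, $N_2=\{p\}$, $P_1=P_2=\emptyset$. 5. $A_0A_1B_1\cdots B_{m-1}B_mB_{m-1}\cdots B_1A_1A_0\equiv B_1'\cdots B_{m-1}'B_m'B_{m-1}'\cdots B_1'$ if $m\ge1$, $Q=\{r_1,\dots,r_m\}$ is a set of $m$ bits, $A_0=\mathbf G[P,N\cup Q,q]$, $A_1=\mathbf G[P\cup Q,N,q]$, and for $1\le i\le m$, $B_i=\mathbf G[P\cup\{q\}\cup\{r_{i+1},\dots,r_m\},N\cup\{r_1,\dots,r_{i-1}\},r_i]$ and $B_i'=\mathbf G[P\cup\{r_{i+1},\dots,r_m\},N\cup\{q\}\cup\{r_1,\dots,r_{i-1}\},r_i]$. Write $\mathbf A\Leftrightarrow\mathbf B$ if $\mathbf A$ can be transformed into $\mathbf B$ by finitely many replacements of a (contiguous) subcircuit that is one side of a rule in $\mathcal{RC}$ by the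 other side. Let $\mathbb H=(a_0,a_1,\dots,a_{2^n-1})$ be any Hamiltonian path of the $n$-hypercube graph (vertex set $\{0,1\}^n$, two strings being adjacent iff they differ in exactly one bit). For $0\le i\le 2^n-2$ let $M_i$ be the gate that exchanges $a_i$ and $a_{i+1}$, i.e. its target is the bit in which they differ, and every other bit is a positive (negative) control if its common value in $a_i,a_{i+1}$ is $1$ ($0$). A circuit is in canonical form based on $\mathbb H$ if it is a concatenation of $r\ge 0$ subcircuits $\mathbf C_{r-1}\cdots\mathbf C_1\mathbf C_0$, each of the form $\mathbf C_i=M_{x_i}M_{x_i+1}\cdots M_{x_i+k_i}$ with $k_i\ge 0$ and $x_i+k_i\le 2^n-2$, such that $x_0<x_1<\dots<x_{r-1}$ (for $r=0$ it is the empty circuit). Then for every $n$-bit reversible circuit $\mathbf C$ there is exactly one circuit $\mathbf D$ in canonical form based on $\mathbb H$ with $\mathbf C\equiv\mathbf D$ (the canonical form of $\mathbf C$), and $\mathbf C\Leftrightarrow\mathbf D$. -/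

import Mathlib

namespace RevCircuit

/-- Bit strings of length `n`; the `n` bits are indexed by `Fin n`. -/
abbrev Bits (n : ℕ) : Type := Fin n → Bool

/-- A mixed polarity multiple-control Toffoli gate `G[P, N, q]` on `n` bits: positive controls
`P = pos`, negative controls `N = neg`, target `q = target`. -/
@[ext]
structure Gate (n : ℕ) where
  pos : Finset (Fin n)
  neg : Finset (Fin n)
  target : Fin n
  disjoint_pos_neg : Disjoint pos neg
  target_notMem : target ∉ pos ∪ neg

/-- `A.IsG P N q` says that `A` is the gate `G[P, N, q]`. In particular `P`, `N`, `q` then satisfy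
the conditions under which `G[P, N, q]` is defined. -/
def Gate.IsG {n : ℕ} (A : Gate n) (P N : Finset (Fin n)) (q : Fin n) : Prop :=
  A.pos = P ∧ A.neg = N ∧ A.target = q

/-- The gate flips its target iff all positive controls are `1` and all negative controls
are `0`. -/
def Gate.apply {n : ℕ} (A : Gate n) (s : Bits n) : Bits n :=
  if (∀ i ∈ A.pos, s i = true) ∧ (∀ i ∈ A.neg, s i = false) then
    Function.update s A.target (!(s A.target))
  else s

/-- An `n`-bit reversible circuit: a sequence of gates on the bits `Fin n`. -/
abbrev Circuit (n : ℕ) : Type := List (Gate n)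

/-- The function computed by a circuit; the leftmost gate executes first. -/
def run {n : ℕ} : Circuit n → Bits n → Bits n
  | [], s => s
  | A :: C, s => run C (A.apply s)

/-- `A ≡ B`: the two circuits compute the same function. -/
def Equivalent {n : ℕ} (A B : Circuit n) : Prop := run A = run B

/-- The circuit `B₁ ⋯ Bₘ₋₁ Bₘ Bₘ₋₁ ⋯ B₁`. -/
def palindrome {n m : ℕ} (B : Fin m → Gate n) : Circuit n :=
  List.ofFn B ++ (List.ofFn B).reverse.tail

/-- The five basic rules of `RC`; `Rule L R` says that `L ≡ R` is an instance of a rule. -/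
inductive Rule {n : ℕ} : Circuit n → Circuit n → Prop
  /-- Two adjacent identical gates cancel. -/
  | elim (A : Gate n) : Rule [A, A] []
  /-- Removing a control bit that occurs in both polarities. -/
  | control (P N : Finset (Fin n)) (p q : Fin n) (A₀ A₁ A : Gate n)
      (h₀ : A₀.IsG P (N ∪ {p}) q) (h₁ : A₁.IsG (P ∪ {p}) N q) (h : A.IsG P N q) :
      Rule [A₀, A₁] [A]
  /-- Gates with a common control bit of opposite polarities commute. -/
  | comm (A B : Gate n)
      (h : (A.pos ∩ B.neg).Nonempty ∨ (B.pos ∩ A.neg).Nonempty) :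
      Rule [A, B] [B, A]
  /-- Moving a SWAP of `p` and `q` through a gate. -/
  | swap (P N P₁ P₂ N₁ N₂ : Finset (Fin n)) (p q : Fin n) (A B C₁ C₂ : Gate n)
      (hA : A.IsG {p} ∅ q) (hB : B.IsG {q} ∅ p)
      (hC₁ : C₁.IsG (P ∪ P₁) (N ∪ N₁) p) (hC₂ : C₂.IsG (P ∪ P₂) (N ∪ N₂) q)
      (h : (P₁ = {q} ∧ P₂ = {p} ∧ N₁ = ∅ ∧ N₂ = ∅) ∨
        (N₁ = {q} ∧ N₂ = {p} ∧ P₁ = ∅ ∧ P₂ = ∅)) :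
      Rule [A, B, A, C₁] [C₂, A, B, A]
  /-- Changing the polarity of `q` in a chain of gates, by conjugation; here `Q` is the set of
  the distinct bits `r 0, …, r (m - 1)`. -/
  | chain (P N : Finset (Fin n)) (q : Fin n) (m : ℕ) (hm : 0 < m) (r : Fin m → Fin n)
      (hr : Function.Injective r) (A₀ A₁ : Gate n) (B B' : Fin m → Gate n)
      (hA₀ : A₀.IsG P (N ∪ Finset.univ.image r) q)
      (hA₁ : A₁.IsG (P ∪ Finset.univ.image r) N q)
      (hB : ∀ i, (B i).IsG ((P ∪ {q}) ∪ (Finset.Ioi i).image r)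
        (N ∪ (Finset.Iio i).image r) (r i))
      (hB' : ∀ i, (B' i).IsG (P ∪ (Finset.Ioi i).image r)
        ((N ∪ {q}) ∪ (Finset.Iio i).image r) (r i)) :
      Rule ([A₀, A₁] ++ palindrome B ++ [A₁, A₀]) (palindrome B')

/-- One application of a rule, from left to right, to a subcircuit. -/
def Step {n : ℕ} (A B : Circuit n) : Prop :=
  ∃ U V L R : Circuit n, Rule L R ∧ A = U ++ L ++ V ∧ B = U ++ R ++ V

/-- `A ⇔ B`: the circuits can be transformed into each other by finitely many applications of the
rules of `RC`, in either direction, to subcircuits. -/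
def Transforms {n : ℕ} (A B : Circuit n) : Prop := Relation.EqvGen Step A B

/-- The `n`-hypercube graph: two strings are adjacent iff they differ in exactly one bit. -/
def hypercube (n : ℕ) : SimpleGraph (Bits n) where
  Adj a b := ∃! j, a j ≠ b j
  symm := ⟨fun _ _ h => by simpa only [ne_comm] using h⟩
  loopless := ⟨fun _ h => h.choose_spec.1 rfl⟩

/-- The `n`-bit gate that exchanges two adjacent strings `a` and `b`: its target is the bit where
they differ, and every other bit is a control whose polarity is the common value. -/
def edgeGate {n : ℕ} {a b : Bits n} (h : (hypercube n).Adj a b) : Gate n where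
  pos := Finset.univ.filter fun j => a j = true ∧ b j = true
  neg := Finset.univ.filter fun j => a j = false ∧ b j = false
  target := Fintype.choose (fun j => a j ≠ b j) h
  disjoint_pos_neg := by
    rw [Finset.disjoint_filter]
    intro j _ h1 h2
    simp [h1.1] at h2
  target_notMem := by
    have hne := Fintype.choose_spec (fun j => a j ≠ b j) h
    intro hmem
    rw [Finset.mem_union, Finset.mem_filter, Finset.mem_filter] at hmem
    rcases hmem with ⟨_, h1, h2⟩ | ⟨_, h1, h2⟩ <;> exact hne (h1.trans h2.symm)

/-- For a path `H = (a₀, a₁, …)` in the hypercube, the gate `Mᵢ` exchanges `aᵢ` and `aᵢ₊₁`. A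
Hamiltonian path has length `2 ^ n - 1`, so that `i` then ranges over `0, …, 2 ^ n - 2`. -/
def M {n : ℕ} {u v : Bits n} (H : (hypercube n).Walk u v) (i : Fin H.length) : Gate n :=
  edgeGate (H.adj_getVert_succ i.isLt)

/-- The data of a nonempty run `M_x M_{x+1} ⋯ M_{x+k}` of consecutive gates along `H`. -/
structure Block {n : ℕ} {u v : Bits n} (H : (hypercube n).Walk u v) where
  x : ℕ
  k : ℕ
  lt_length : x + k < H.length

/-- The circuit `M_x M_{x+1} ⋯ M_{x+k}`. -/
def Block.circuit {n : ℕ} {u v : Bits n} {H : (hypercube n).Walk u v} (b : Block H) : Circuit n :=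
  List.ofFn fun j : Fin (b.k + 1) =>
    M H ⟨b.x + j, lt_of_le_of_lt (Nat.add_le_add_left (Nat.le_of_lt_succ j.isLt) b.x) b.lt_length⟩

/-- A circuit is in canonical form based on `H` if it is a concatenation of (possibly zero) blocks
whose first indices strictly decrease from left to right. -/
def IsCanonical {n : ℕ} {u v : Bits n} (H : (hypercube n).Walk u v) (D : Circuit n) : Prop :=
  ∃ bs : List (Block H), bs.Pairwise (fun b c => c.x < b.x) ∧ D = (bs.map Block.circuit).flatten

/-- `D` is a canonical form of `C` based on `H`: it is in canonical form and computes the same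
function as `C`. -/
def IsCanonicalFormOf {n : ℕ} {u v : Bits n} (H : (hypercube n).Walk u v) (C D : Circuit n) :
    Prop :=
  IsCanonical H D ∧ Equivalent C D

end RevCircuit

/-! Circuits modulo the rules form a group, since every gate is its own inverse. Removing redundant
controls (`tc_split`) makes the fully controlled gates generate it; such a gate `tr b i` is a
transposition along an edge of the hypercube. The path gates `pathGen H i` are the adjacent
transpositions of the order that `H` puts on the strings, so a canonical form is the usual normal
form of a permutation for these Coxeter generators. The rules must supply two things: the Coxeter
relations for the path gates, and the fact that these gates generate every `tr b i`.

Disjoint edges commute by `Rule.comm`. On each square of the hypercube, `Rule.swap` and the one-bit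
case of `Rule.chain` yield the braid relations and the equality of the two conjugates that represent
a diagonal (`tr_square`).

For generation, fix `a` and represent the transposition of `a` and `b` by conjugating an edge along
a shortest path. The square relation makes the result independent of the path
(`transpositionAux_spec`), and conjugation by any edge avoiding `a` then moves the second endpoint
(`exists_transposition`). Travelling along `H` from one end of an edge to the other writes that edge
through path gates (`tr_mem_closure`).

The Coxeter relations keep canonical words stable under right multiplication by a path gate
(`CanonicalFrom.mul_pathGen`), which gives existence. Uniqueness is semantic: the first moved vertex
of `H` and its image determine the last block, which is then cancelled (`blocks_unique`). -/

namespace RevCircuit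

variable {n : ℕ}

/-! ### Bit flips and gates whose polarities are read off a string -/

/-- The string `b` with bit `i` flipped. -/
def flip (b : Bits n) (i : Fin n) : Bits n := Function.update b i (!(b i))

@[simp] theorem flip_same (b : Bits n) (i : Fin n) : flip b i i = !(b i) := by simp [flip]

theorem flip_of_ne (b : Bits n) {i j : Fin n} (h : j ≠ i) : flip b i j = b j := by simp [flip, h]

theorem flip_apply (b : Bits n) (i j : Fin n) :
    flip b i j = if j = i then !(b j) else b j := by
  by_cases h : j = i
  · subst h; simp
  · simp [h, flip_of_ne]

@[simp] theorem flip_flip (b : Bits n) (i : Fin n) : flip (flip b i) i = b := by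
  ext j; by_cases h : j = i <;> simp [flip_apply, h]

theorem flip_comm (b : Bits n) (i j : Fin n) : flip (flip b i) j = flip (flip b j) i := by
  ext k; simp only [flip_apply]; split_ifs <;> rfl

theorem flip_ne (b : Bits n) (i : Fin n) : flip b i ≠ b := fun h => by
  have := congrFun h i
  simp at this

/-- The gate with target `i` and controls `S \ {i}`, whose polarities are read off `b`. -/
def ctl (S : Finset (Fin n)) (b : Bits n) (i : Fin n) : Gate n where
  pos := (S.erase i).filter fun j => b j = true
  neg := (S.erase i).filter fun j => b j = false
  target := i
  disjoint_pos_neg := by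
    rw [Finset.disjoint_filter]
    intro j _ h
    simp [h]
  target_notMem := by simp

theorem ctl_apply (S : Finset (Fin n)) (b : Bits n) (i : Fin n) (s : Bits n) :
    (ctl S b i).apply s = if ∀ j ∈ S, j ≠ i → s j = b j then flip s i else s := by
  have : ((∀ j ∈ (ctl S b i).pos, s j = true) ∧ (∀ j ∈ (ctl S b i).neg, s j = false)) ↔
      ∀ j ∈ S, j ≠ i → s j = b j := by
    simp only [ctl, Finset.mem_filter, Finset.mem_erase]
    constructor
    · rintro ⟨h₁, h₂⟩ j hj hji
      cases hb : b j
      · exact h₂ j ⟨⟨hji, hj⟩, hb⟩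
      · exact h₁ j ⟨⟨hji, hj⟩, hb⟩
    · intro h
      exact ⟨fun j hj => (h j hj.1.2 hj.1.1).trans hj.2,
        fun j hj => (h j hj.1.2 hj.1.1).trans hj.2⟩
  simp only [Gate.apply, this]
  rfl

theorem ctl_congr {S T : Finset (Fin n)} {b c : Bits n} {i : Fin n}
    (hST : S.erase i = T.erase i) (hbc : ∀ j ∈ S.erase i, b j = c j) : ctl S b i = ctl T c i := by
  apply Gate.ext
  · simp only [ctl, ← hST]
    exact Finset.filter_congr fun j hj => by rw [hbc j hj]
  · simp only [ctl, ← hST]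
    exact Finset.filter_congr fun j hj => by rw [hbc j hj]
  · rfl

theorem Gate.eq_ctl (A : Gate n) :
    A = ctl (A.pos ∪ A.neg) (fun j => decide (j ∈ A.pos)) A.target := by
  have h := A.target_notMem
  have hd := Finset.disjoint_left.1 A.disjoint_pos_neg
  apply Gate.ext
  · ext j
    simp only [ctl, Finset.erase_eq_of_notMem h, Finset.mem_filter, Finset.mem_union,
      decide_eq_true_eq]
    tauto
  · ext j
    have := @hd j
    simp only [ctl, Finset.erase_eq_of_notMem h, Finset.mem_filter, Finset.mem_union,
      decide_eq_false_iff_not]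
    tauto
  · rfl

theorem Gate.apply_apply (A : Gate n) (s : Bits n) : A.apply (A.apply s) = s := by
  rw [A.eq_ctl]
  generalize A.pos ∪ A.neg = S
  generalize (fun j => decide (j ∈ A.pos)) = b
  generalize A.target = i
  rw [ctl_apply S b i s]
  split_ifs with h
  · rw [ctl_apply, if_pos, flip_flip]
    intro j hj hji
    rw [flip_of_ne _ hji, h j hj hji]
  · rw [ctl_apply, if_neg h]

/-! ### The group of circuits modulo the rules -/

theorem run_append (C D : Circuit n) (s : Bits n) : run (C ++ D) s = run D (run C s) := by
  induction C generalizing s with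
  | nil => rfl
  | cons A C ih => exact ih _

theorem run_injective (C : Circuit n) : Function.Injective (run C) := by
  induction C with
  | nil => exact fun _ _ h => h
  | cons A C ih =>
    intro s t h
    have := congrArg A.apply (ih h)
    rwa [A.apply_apply, A.apply_apply] at this

theorem Transforms.append {C C' D D' : Circuit n} (h : Transforms C C') (h' : Transforms D D') :
    Transforms (C ++ D) (C' ++ D') := by
  have h₁ : Transforms (C ++ D) (C' ++ D) := by
    clear h'
    induction h with
    | rel A B h =>
      obtain ⟨U, V, L, R, hr, rfl, rfl⟩ := h
      exact .rel _ _ ⟨U, V ++ D, L, R, hr, by simp, by simp⟩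
    | refl A => exact .refl _
    | symm A B _ ih => exact .symm _ _ ih
    | trans A B C _ _ ih ih' => exact .trans _ _ _ ih ih'
  refine .trans _ _ _ h₁ ?_
  clear h h₁
  induction h' with
  | rel A B h =>
    obtain ⟨U, V, L, R, hr, rfl, rfl⟩ := h
    exact .rel _ _ ⟨C' ++ U, V, L, R, hr, by simp, by simp⟩
  | refl A => exact .refl _
  | symm A B _ ih => exact .symm _ _ ih
  | trans A B C _ _ ih ih' => exact .trans _ _ _ ih ih'

theorem Rule.transforms {L R : Circuit n} (h : Rule L R) : Transforms L R :=
  .rel _ _ ⟨[], [], L, R, h, by simp, by simp⟩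

/-- Circuits that compute the same function and can be transformed into each other. -/
instance circuitSetoid (n : ℕ) : Setoid (Circuit n) where
  r C D := Transforms C D ∧ Equivalent C D
  iseqv :=
    ⟨fun _ => ⟨.refl _, rfl⟩, fun h => ⟨.symm _ _ h.1, h.2.symm⟩,
      fun h h' => ⟨.trans _ _ _ h.1 h'.1, h.2.trans h'.2⟩⟩

theorem append_equiv {C C' D D' : Circuit n} (h : C ≈ C') (h' : D ≈ D') :
    C ++ D ≈ C' ++ D' := by
  refine ⟨h.1.append h'.1, ?_⟩
  have e₁ : run C = run C' := h.2
  have e₂ : run D = run D' := h'.2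
  funext s
  rw [run_append, run_append, e₁, e₂]

theorem elim_equiv (A : Gate n) : ([A, A] : Circuit n) ≈ [] :=
  ⟨(Rule.elim A).transforms, funext fun s => A.apply_apply s⟩

theorem reverse_append_equiv (C : Circuit n) : C.reverse ++ C ≈ [] := by
  induction C with
  | nil => exact Setoid.refl _
  | cons A C ih =>
    have h := append_equiv (append_equiv (Setoid.refl C.reverse) (elim_equiv A)) (Setoid.refl C)
    refine Setoid.trans ?_ ih
    simpa using h

/-- A reversed circuit is an inverse, and inverses are unique: `C.reverse ++ C ++ D.reverse` reduces
to either side. Inversion is thus well defined on classes. -/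
theorem reverse_equiv {C D : Circuit n} (h : C ≈ D) : C.reverse ≈ D.reverse := by
  have h₁ : C.reverse ++ (D ++ D.reverse) ≈ C.reverse := by
    simpa using append_equiv (Setoid.refl C.reverse) (reverse_append_equiv D.reverse)
  have h₂ : C.reverse ++ C ++ D.reverse ≈ D.reverse := by
    simpa using append_equiv (reverse_append_equiv C) (Setoid.refl D.reverse)
  have h₃ : C.reverse ++ C ++ D.reverse ≈ C.reverse ++ (D ++ D.reverse) := by
    rw [List.append_assoc]
    exact append_equiv (Setoid.refl _) (append_equiv h (Setoid.refl _))
  exact Setoid.trans (Setoid.symm h₁) (Setoid.trans (Setoid.symm h₃) h₂)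

/-- The group of circuits modulo the rules. -/
abbrev CircuitGroup (n : ℕ) : Type := Quotient (circuitSetoid n)

/-- The class of a circuit. -/
def cls (C : Circuit n) : CircuitGroup n := Quotient.mk _ C

instance : Mul (CircuitGroup n) :=
  ⟨Quotient.map₂ (· ++ ·) fun _ _ h _ _ h' => append_equiv h h'⟩

instance : One (CircuitGroup n) := ⟨cls []⟩

instance : Inv (CircuitGroup n) := ⟨Quotient.map List.reverse fun _ _ h => reverse_equiv h⟩

theorem cls_append (C D : Circuit n) : cls (C ++ D) = cls C * cls D := rfl

instance : Group (CircuitGroup n) :=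
  Group.ofLeftAxioms
    (by
      rintro ⟨C⟩ ⟨D⟩ ⟨E⟩
      exact congrArg cls (List.append_assoc C D E))
    (by rintro ⟨C⟩; rfl)
    (by rintro ⟨C⟩; exact Quotient.sound (reverse_append_equiv C))

theorem cls_cons (A : Gate n) (C : Circuit n) : cls (A :: C) = cls [A] * cls C := rfl

/-- The setoid also records equality of functions, so soundness is checked only for the rule
instances in use, never for the rules in general. -/
theorem cls_eq_of_rule {L R : Circuit n} (h : Rule L R) (h' : ∀ s, run L s = run R s) :
    cls L = cls R :=
  Quotient.sound ⟨h.transforms, funext h'⟩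

theorem cls_mul_self (A : Gate n) : cls [A] * cls [A] = 1 := Quotient.sound (elim_equiv A)

/-! ### Commuting gates and adding controls -/

/-- The class of the gate `ctl S b i`. -/
def tc (S : Finset (Fin n)) (b : Bits n) (i : Fin n) : CircuitGroup n := cls [ctl S b i]

theorem tc_mul_self (S : Finset (Fin n)) (b : Bits n) (i : Fin n) : tc S b i * tc S b i = 1 :=
  cls_mul_self _

theorem tc_comm {S T : Finset (Fin n)} {b d : Bits n} {i j c : Fin n} (hS : c ∈ S) (hT : c ∈ T)
    (hi : c ≠ i) (hj : c ≠ j) (h : b c ≠ d c) : tc S b i * tc T d j = tc T d j * tc S b i := by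
  refine cls_eq_of_rule (Rule.comm _ _ ?_) fun s => ?_
  · cases hb : b c
    · have hd : d c = true := by simpa [hb] using h
      exact .inr ⟨c, by simp [ctl, *]⟩
    · have hd : d c = false := by simpa [hb] using h
      exact .inl ⟨c, by simp [ctl, *]⟩
  · change (ctl T d j).apply ((ctl S b i).apply s) = (ctl S b i).apply ((ctl T d j).apply s)
    by_cases hs : s c = b c
    · have h₁ : ∀ s : Bits n, s c = b c → (ctl T d j).apply s = s := fun s hs => by
        rw [ctl_apply, if_neg]
        exact fun h' => h (hs.symm.trans (h' c hT hj))
      rw [h₁ s hs, h₁]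
      rw [ctl_apply]
      split_ifs
      · rwa [flip_of_ne _ hi]
      · exact hs
    · have h₁ : ∀ s : Bits n, s c ≠ b c → (ctl S b i).apply s = s := fun s hs => by
        rw [ctl_apply, if_neg]
        exact fun h' => hs (h' c hS hi)
      rw [h₁ s hs, h₁]
      rw [ctl_apply]
      split_ifs
      · rwa [flip_of_ne _ hj]
      · exact hs

theorem tc_split {S : Finset (Fin n)} {b : Bits n} {i c : Fin n} (hc : c ∉ S) (hci : c ≠ i) :
    tc S b i = tc (insert c S) b i * tc (insert c S) (flip b c) i := by
  -- `Rule.control` puts the negative control first. For the other polarity the factors come out in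
  -- reverse order, and they commute because they disagree at `c`.
  wlog hb : b c = false generalizing b
  · have h := this (b := flip b c) (by simpa using hb)
    rw [flip_flip] at h
    rw [tc_comm (c := c) (by simp) (by simp) hci hci (by simp), ← h]
    refine congrArg (fun A => cls [A]) (ctl_congr rfl fun j hj => (flip_of_ne _ ?_).symm)
    rintro rfl
    exact hc (Finset.mem_of_mem_erase hj)
  · symm
    refine cls_eq_of_rule (Rule.control ((S.erase i).filter fun j => b j = true)
      ((S.erase i).filter fun j => b j = false) c i _ _ _ ⟨?_, ?_, rfl⟩ ⟨?_, ?_, rfl⟩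
      ⟨rfl, rfl, rfl⟩) fun s => ?_
    · ext j
      by_cases h : j = c
      · subst h; simp [ctl, hc, hb]
      · simp [ctl, h]
    · ext j
      by_cases h : j = c
      · subst h; simp [ctl, hb, hci]
      · simp [ctl, h]
    · ext j
      by_cases h : j = c
      · subst h; simp [ctl, hb, hci]
      · simp [ctl, h, flip_of_ne]
    · ext j
      by_cases h : j = c
      · subst h; simp [ctl, hc, hb]
      · simp [ctl, h, flip_of_ne]
    · change (ctl (insert c S) (flip b c) i).apply ((ctl (insert c S) b i).apply s) =
        (ctl S b i).apply s
      have h₂ : ∀ s : Bits n, (∀ j ∈ S, j ≠ i → s j = flip b c j) ↔ ∀ j ∈ S, j ≠ i → s j = b j := by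
        intro s
        refine forall₂_congr fun j hj => ?_
        rw [flip_of_ne]
        rintro rfl
        exact hc hj
      have h₃ : ∀ s : Bits n, (∀ j ∈ S, j ≠ i → flip s i j = b j) ↔ ∀ j ∈ S, j ≠ i → s j = b j := by
        intro s
        refine forall₂_congr fun j hj => forall_congr' fun hji => ?_
        rw [flip_of_ne _ hji]
      simp only [ctl_apply, Finset.forall_mem_insert, h₂, flip_same, hci, ne_eq, not_false_eq_true,
        forall_true_left] at h₃ ⊢
      by_cases hS : ∀ j ∈ S, ¬j = i → s j = b j
      · cases hs : s c <;> simp [hb, hs, eq_true hS, eq_true ((h₃ s).2 hS), flip_of_ne _ hci]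
      · simp [hS]

/-! ### Exchanging two bits -/

theorem run_cnot_cnot_cnot {b : Bits n} {p q : Fin n} (hpq : p ≠ q) (hp : b p = true)
    (hq : b q = true) (s : Bits n) :
    run [ctl {p} b q, ctl {q} b p, ctl {p} b q] s = s ∘ Equiv.swap p q := by
  have hA : ∀ s, (ctl {p} b q).apply s = if s p = true then flip s q else s := fun s => by
    simp [ctl_apply, hpq, hp]
  have hB : ∀ s, (ctl {q} b p).apply s = if s q = true then flip s p else s := fun s => by
    simp [ctl_apply, hpq.symm, hq]
  simp only [run, hA, hB]
  funext j
  by_cases hjp : j = p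
  · subst hjp
    cases h₁ : s j <;> cases h₂ : s q <;> simp [flip_apply, h₁, h₂, hpq]
  · by_cases hjq : j = q
    · subst hjq
      cases h₁ : s p <;> cases h₂ : s j <;> simp [flip_apply, h₁, h₂, hpq, hpq.symm]
    · rw [Function.comp_apply, Equiv.swap_apply_of_ne_of_ne hjp hjq]
      cases h₁ : s p <;> cases h₂ : s q <;>
        simp [flip_apply, h₁, h₂, hpq, hjp, hjq]

theorem ctl_univ_apply_comp_swap (d : Bits n) (p q : Fin n) (s : Bits n) :
    (ctl Finset.univ d p).apply (s ∘ Equiv.swap p q) =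
      (ctl Finset.univ (d ∘ Equiv.swap p q) q).apply s ∘ Equiv.swap p q := by
  have h : (∀ j ∈ Finset.univ, j ≠ p → (s ∘ Equiv.swap p q) j = d j) ↔
      ∀ j ∈ Finset.univ, j ≠ q → s j = (d ∘ Equiv.swap p q) j := by
    simp only [Finset.mem_univ, forall_true_left, Function.comp_apply]
    constructor
    · intro h j hj
      have := h (Equiv.swap p q j) (fun e => hj (by
        rw [Equiv.swap_apply_eq_iff] at e; simpa using e))
      simpa using this
    · intro h j hj
      have := h (Equiv.swap p q j) (fun e => hj (by
        rw [Equiv.swap_apply_eq_iff] at e; simpa using e))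
      simpa using this
  rw [ctl_apply, ctl_apply]
  simp only [h]
  split_ifs
  · funext j
    simp only [flip_apply, Function.comp_apply, Equiv.swap_apply_eq_iff, Equiv.swap_apply_right]
  · rfl

theorem swap_rel {b d : Bits n} {p q : Fin n} (hpq : p ≠ q) (hp : b p = true)
    (hq : b q = true) :
    tc {p} b q * tc {q} b p * tc {p} b q * tc Finset.univ d p =
      tc Finset.univ (d ∘ Equiv.swap p q) q * (tc {p} b q * tc {q} b p * tc {p} b q) := by
  refine cls_eq_of_rule (L := [ctl {p} b q, ctl {q} b p, ctl {p} b q, ctl Finset.univ d p])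
    (R := [ctl Finset.univ (d ∘ Equiv.swap p q) q, ctl {p} b q, ctl {q} b p, ctl {p} b q])
    -- The control `q` of the gate on `p` keeps its polarity `d q` and becomes the control `p` of
    -- the gate on `q`, hence the conditional sets.
    (Rule.swap ({j | j ≠ p ∧ j ≠ q ∧ d j = true} : Finset (Fin n))
      ({j | j ≠ p ∧ j ≠ q ∧ d j = false} : Finset (Fin n))
      (if d q = true then {q} else ∅) (if d q = true then {p} else ∅)
      (if d q = false then {q} else ∅) (if d q = false then {p} else ∅)
      p q _ _ _ _ ⟨?_, ?_, rfl⟩ ⟨?_, ?_, rfl⟩ ⟨?_, ?_, rfl⟩ ⟨?_, ?_, rfl⟩ ?_) fun s => ?_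
  · ext j; by_cases h : j = p <;> simp [ctl, h, hpq, hp]
  · ext j; by_cases h : j = p <;> simp [ctl, h, hp]
  · ext j; by_cases h : j = q <;> simp [ctl, h, hpq.symm, hq]
  · ext j; by_cases h : j = q <;> simp [ctl, h, hq]
  · ext j
    by_cases h : j = p
    · subst h; cases hd : d q <;> simp [ctl, hpq]
    · by_cases h' : j = q
      · subst h'; cases hd : d j <;> simp [ctl, h, hd]
      · cases hd : d q <;> simp [ctl, h, h']
  · ext j
    by_cases h : j = p
    · subst h; cases hd : d q <;> simp [ctl, hpq]
    · by_cases h' : j = q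
      · subst h'; cases hd : d j <;> simp [ctl, h, hd]
      · cases hd : d q <;> simp [ctl, h, h']
  · ext j
    by_cases h : j = p
    · subst h; cases hd : d q <;> simp [ctl, hpq, hd]
    · by_cases h' : j = q
      · subst h'; cases hd : d j <;> simp [ctl, h]
      · cases hd : d q <;> simp [ctl, h, h', Equiv.swap_apply_of_ne_of_ne h h']
  · ext j
    by_cases h : j = p
    · subst h; cases hd : d q <;> simp [ctl, hpq, hd]
    · by_cases h' : j = q
      · subst h'; cases hd : d j <;> simp [ctl, h]
      · cases hd : d q <;> simp [ctl, h, h', Equiv.swap_apply_of_ne_of_ne h h']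
  · cases hd : d q <;> simp
  · have h₁ := run_append [ctl {p} b q, ctl {q} b p, ctl {p} b q] [ctl Finset.univ d p] s
    have h₂ := run_append [ctl Finset.univ (d ∘ Equiv.swap p q) q]
      [ctl {p} b q, ctl {q} b p, ctl {p} b q] s
    refine h₁.trans (Eq.trans ?_ h₂.symm)
    rw [run_cnot_cnot_cnot hpq hp hq, run_cnot_cnot_cnot hpq hp hq]
    exact ctl_univ_apply_comp_swap d p q s

/-- The commutations separate the product into `A₁ * B₁ * A₁` times `A₀ * B₀ * A₀`. The second
factor commutes with `C` and cancels. -/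
theorem conj_rel_of_commuting_factor {G : Type*} [Group G] {A₀ A₁ B₀ B₁ C D : G}
    (hAA : Commute A₀ A₁) (hAB : Commute A₀ B₁) (hBA : Commute B₀ A₁)
    (hAC : Commute A₀ C) (hBC : Commute B₀ C)
    (h : A₁ * A₀ * (B₁ * B₀) * (A₁ * A₀) * C = D * (A₁ * A₀ * (B₁ * B₀) * (A₁ * A₀))) :
    A₁ * B₁ * A₁ * C = D * (A₁ * B₁ * A₁) := by
  have e : A₁ * A₀ * (B₁ * B₀) * (A₁ * A₀) = A₁ * B₁ * A₁ * (A₀ * B₀ * A₀) := by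
    calc A₁ * A₀ * (B₁ * B₀) * (A₁ * A₀)
        = A₁ * (A₀ * B₁) * (B₀ * A₁) * A₀ := by simp only [mul_assoc]
      _ = A₁ * B₁ * (A₀ * A₁) * B₀ * A₀ := by rw [hAB.eq, hBA.eq]; simp only [mul_assoc]
      _ = _ := by rw [hAA.eq]; simp only [mul_assoc]
  have hc : Commute (A₀ * B₀ * A₀) C := (hAC.mul_left hBC).mul_left hAC
  refine mul_right_cancel (b := A₀ * B₀ * A₀) ?_
  rwa [e, mul_assoc _ _ C, hc.eq, ← mul_assoc _ C, ← mul_assoc D] at h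

/-- Controls are added to the three conjugating gates one at a time. Splitting on `c` produces gates
of both polarities; those with polarity opposite to `b c` commute with the full gate on `p`, because
`d c = b c`, so they drop out. -/
theorem swap_rel_of_subset {b d : Bits n} {p q : Fin n} (hpq : p ≠ q) (hp : b p = true)
    (hq : b q = true) (hd : ∀ j, j ≠ p → j ≠ q → d j = b j) (S : Finset (Fin n))
    (hpS : p ∉ S) (hqS : q ∉ S) :
    tc (insert p S) b q * tc (insert q S) b p * tc (insert p S) b q * tc Finset.univ d p =
      tc Finset.univ (d ∘ Equiv.swap p q) q *
        (tc (insert p S) b q * tc (insert q S) b p * tc (insert p S) b q) := by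
  induction S using Finset.induction_on with
  | empty => exact swap_rel hpq hp hq
  | insert c S hc ih =>
    simp only [Finset.mem_insert, not_or] at hpS hqS
    have hcp : c ≠ p := Ne.symm hpS.1
    have hcq : c ≠ q := Ne.symm hqS.1
    have h := ih hpS.2 hqS.2
    rw [tc_split (S := insert p S) (b := b) (i := q) (c := c) (by simp [hc, hcp]) hcq,
      tc_split (S := insert q S) (b := b) (i := p) (c := c) (by simp [hc, hcq]) hcp] at h
    rw [Finset.insert_comm p c, Finset.insert_comm q c]
    refine conj_rel_of_commuting_factor ?_ ?_ ?_ ?_ ?_ h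
    all_goals
      refine tc_comm (c := c) (by simp) (by simp) ?_ ?_ ?_ <;>
        simp [hcp, hcq, hd c hcp hcq]

/-! ### Relations between edges of the hypercube -/

/-- The class of the gate that exchanges `b` and `flip b i`. -/
def tr (b : Bits n) (i : Fin n) : CircuitGroup n := tc Finset.univ b i

theorem tr_mul_self (b : Bits n) (i : Fin n) : tr b i * tr b i = 1 := tc_mul_self _ _ _

theorem tr_congr {b c : Bits n} {i : Fin n} (h : ∀ j, j ≠ i → b j = c j) : tr b i = tr c i :=
  congrArg (fun A => cls [A]) (ctl_congr rfl fun j hj => h j (Finset.ne_of_mem_erase hj))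

@[simp] theorem tr_flip (b : Bits n) (i : Fin n) : tr (flip b i) i = tr b i :=
  tr_congr fun _ hj => flip_of_ne _ hj

theorem tr_swap {b d : Bits n} {p q : Fin n} (hpq : p ≠ q) (hp : b p = true)
    (hq : b q = true) (hd : ∀ j, j ≠ p → j ≠ q → d j = b j) :
    tr b q * tr b p * tr b q * tr d p =
      tr (d ∘ Equiv.swap p q) q * (tr b q * tr b p * tr b q) := by
  have h := swap_rel_of_subset hpq hp hq hd ({p, q} : Finset (Fin n))ᶜ (by simp) (by simp)
  have e₁ : tc (insert p ({p, q} : Finset (Fin n))ᶜ) b q = tr b q :=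
    congrArg (fun A => cls [A]) (ctl_congr (by ext j; simp; tauto) fun _ _ => rfl)
  have e₂ : tc (insert q ({p, q} : Finset (Fin n))ᶜ) b p = tr b p :=
    congrArg (fun A => cls [A]) (ctl_congr (by ext j; simp; tauto) fun _ _ => rfl)
  rwa [e₁, e₂] at h

/-- This is `Rule.chain` with the single bit `p`, the only length needed: three sides of a square
express the fourth. -/
theorem tr_chain {b : Bits n} {p q : Fin n} (hpq : p ≠ q) (hp : b p = true) (hq : b q = true) :
    tr (flip b p) q * tr b q * tr b p * tr b q * tr (flip b p) q = tr (flip b q) p := by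
  refine cls_eq_of_rule
    (L := [ctl Finset.univ (flip b p) q, ctl Finset.univ b q] ++
      palindrome (fun _ : Fin 1 => ctl Finset.univ b p) ++
      [ctl Finset.univ b q, ctl Finset.univ (flip b p) q])
    (R := palindrome (fun _ : Fin 1 => ctl Finset.univ (flip b q) p))
    (Rule.chain ({j | j ≠ p ∧ j ≠ q ∧ b j = true} : Finset (Fin n))
      ({j | j ≠ p ∧ j ≠ q ∧ b j = false} : Finset (Fin n)) q 1 one_pos (fun _ => p)
      (fun _ _ _ => Subsingleton.elim _ _) _ _ _ _ ⟨?_, ?_, rfl⟩ ⟨?_, ?_, rfl⟩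
      (fun i => ⟨?_, ?_, rfl⟩) (fun i => ⟨?_, ?_, rfl⟩)) fun s => ?_
  iterate 8
    ext j
    by_cases h : j = p
    · subst h; simp [ctl, hpq, hp, Subsingleton.elim _ (0 : Fin 1)]
    · by_cases h' : j = q
      · subst h'; simp [ctl, h, hq, Subsingleton.elim _ (0 : Fin 1)]
      · simp [ctl, h, h', flip_of_ne, Subsingleton.elim _ (0 : Fin 1)]
  -- All gates here act trivially off the square through `b`; inside it, soundness is a check of the
  -- four values of bits `p` and `q`.
  let E : Bits n → Prop := fun s => ∀ k, k ≠ p → k ≠ q → s k = b k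
  have hE : ∀ s i, i = p ∨ i = q → (E (flip s i) ↔ E s) := fun s i hi =>
    forall_congr' fun k => forall₂_congr fun hkp hkq => by
      rw [flip_of_ne]
      rcases hi with rfl | rfl <;> assumption
  have key : ∀ (d : Bits n) (i j : Fin n), E d → (i = p ∧ j = q ∨ i = q ∧ j = p) → ∀ s,
      (ctl Finset.univ d i).apply s = if E s ∧ s j = d j then flip s i else s := by
    intro d i j hd hij s
    rw [ctl_apply]
    congr 1
    simp only [Finset.mem_univ, forall_true_left, eq_iff_iff]
    constructor
    · refine fun h => ⟨fun k hkp hkq => ?_, h j ?_⟩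
      · rw [h k (by rcases hij with ⟨rfl, rfl⟩ | ⟨rfl, rfl⟩ <;> assumption), hd k hkp hkq]
      · rcases hij with ⟨rfl, rfl⟩ | ⟨rfl, rfl⟩
        · exact hpq.symm
        · exact hpq
    · rintro ⟨h₁, h₂⟩ k hk
      by_cases hkj : k = j
      · rwa [hkj]
      · have : k ≠ p ∧ k ≠ q := by rcases hij with ⟨rfl, rfl⟩ | ⟨rfl, rfl⟩ <;> tauto
        rw [h₁ k this.1 this.2, hd k this.1 this.2]
  have hb : E b := fun _ _ _ => rfl
  change (ctl _ _ q).apply ((ctl _ _ q).apply ((ctl _ _ p).apply ((ctl _ _ q).apply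
    ((ctl _ _ q).apply s)))) = (ctl _ _ p).apply s
  rw [key (flip b q) p q ((hE _ _ (.inr rfl)).2 hb) (by simp)]
  simp only [key (flip b p) q p ((hE _ _ (.inl rfl)).2 hb) (by simp), key b q p hb (by simp),
    key b p q hb (by simp), hp, hq, flip_same]
  by_cases hs : E s
  · cases h₁ : s p <;> cases h₂ : s q <;>
      simp [hs, hE, h₁, h₂, flip_of_ne _ hpq, flip_comm _ p q]
  · simp [hs]

/-- Two edges without a common endpoint give commuting elements. -/
theorem tr_comm {b c : Bits n} {i j : Fin n} (h₁ : c ≠ b) (h₂ : c ≠ flip b i)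
    (h₃ : flip c j ≠ b) (h₄ : flip c j ≠ flip b i) : Commute (tr b i) (tr c j) := by
  -- If the strings differed only within `{i, j}`, the two edges would share an endpoint.
  have : ∃ k, k ≠ i ∧ k ≠ j ∧ b k ≠ c k := by
    by_contra! h
    by_cases hi : b i = c i
    · by_cases hj : b j = c j
      · refine h₁ (funext fun k => ?_)
        have := h k
        cases hbk : b k <;> cases hck : c k <;> grind
      · refine h₃ (funext fun k => ?_)
        have := h k
        rw [flip_apply]
        cases hbk : b k <;> cases hck : c k <;> grind
    · by_cases hj : i ≠ j ∧ b j ≠ c j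
      · refine h₄ (funext fun k => ?_)
        have := h k
        rw [flip_apply, flip_apply]
        cases hbk : b k <;> cases hck : c k <;> grind
      · refine h₂ (funext fun k => ?_)
        have := h k
        rw [flip_apply]
        cases hbk : b k <;> cases hck : c k <;> grind
  obtain ⟨k, hi, hj, hk⟩ := this
  exact tc_comm (Finset.mem_univ k) (Finset.mem_univ k) hi hj hk

/-- `A`, `A'` and `B`, `B'` are the two pairs of opposite sides of a square. The hypotheses `h₁`,
`h₂` come from the swap rule and `h₃` from the chain rule; eliminating `B'` by `h₃` leaves word
manipulations with involutions. -/
theorem square_relations {G : Type*} [Group G] {A B A' B' : G} (hA : A * A = 1)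
    (hA' : A' * A' = 1) (hAA' : A * A' = A' * A) (h₁ : A * B * A * B = A * (A * B * A))
    (h₂ : A * B * A * B' = A' * (A * B * A)) (h₃ : A' * A * B * A * A' = B') :
    A * B * A = B * A * B ∧ A' * B * A' = B * A' * B ∧ A * B' * A = B' * A * B' ∧
      A' * B' * A' = B' * A' * B' ∧ A * B * A = A' * B' * A' ∧ A' * B * A' = A * B' * A := by
  have cA : ∀ x, A * (A * x) = x := fun x => by rw [← mul_assoc, hA, one_mul]
  have cA' : ∀ x, A' * (A' * x) = x := fun x => by rw [← mul_assoc, hA', one_mul]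
  have cc : ∀ x, A * (A' * x) = A' * (A * x) := fun x => by
    rw [← mul_assoc, hAA', mul_assoc]
  have b₁ : A * B * A = B * A * B := by
    have := congrArg (fun x => A * x) h₁
    simp only [mul_assoc, cA] at this ⊢
    exact this.symm
  subst h₃
  have b₂ : A' * B * A' = B * A' * B := by
    have := congrArg (fun x => A * x * (A' * A)) h₂
    simp only [mul_assoc, cA, cc, cA', hA, mul_one] at this ⊢
    exact this.symm
  have d₁ : A * B * A = A' * (A' * A * B * A * A') * A' := by
    simp only [mul_assoc, cA', hA', mul_one]
  have d₂ : A' * B * A' = A * (A' * A * B * A * A') * A := by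
    simp only [mul_assoc, cA, cc, ← hAA']
  refine ⟨b₁, b₂, ?_, ?_, d₁, d₂⟩
  · rw [← d₂]
    calc A' * B * A' = A' * (A * (A * B * A) * A) * A' := by
          simp only [mul_assoc, cA, hA, mul_one]
      _ = A' * (A * (B * A * B) * A) * A' := by rw [b₁]
      _ = _ := by simp only [mul_assoc, cA, cc, cA']
  · rw [← d₁]
    calc A * B * A = A' * A * (A' * B * A') * A * A' := by
          simp only [mul_assoc, cA', ← hAA', hA', mul_one]
      _ = A' * A * (B * A' * B) * A * A' := by rw [b₂]
      _ = _ := by simp only [mul_assoc, cA, cc, cA']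

theorem tr_square_of_true {b : Bits n} {p q : Fin n} (hpq : p ≠ q) (hp : b p = true)
    (hq : b q = true) :
    tr b q * tr b p * tr b q = tr b p * tr b q * tr b p ∧
    tr (flip b p) q * tr b p * tr (flip b p) q = tr b p * tr (flip b p) q * tr b p ∧
    tr b q * tr (flip b q) p * tr b q = tr (flip b q) p * tr b q * tr (flip b q) p ∧
    tr (flip b p) q * tr (flip b q) p * tr (flip b p) q =
      tr (flip b q) p * tr (flip b p) q * tr (flip b q) p ∧
    tr b q * tr b p * tr b q = tr (flip b p) q * tr (flip b q) p * tr (flip b p) q ∧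
    tr (flip b p) q * tr b p * tr (flip b p) q = tr b q * tr (flip b q) p * tr b q := by
  have hb : ∀ j, Equiv.swap p q j ≠ j → b (Equiv.swap p q j) = b j := by
    intro j hj
    by_cases h₁ : j = p
    · subst h₁; simp [hp, hq]
    · by_cases h₂ : j = q
      · subst h₂; simp [hp, hq]
      · exact absurd (Equiv.swap_apply_of_ne_of_ne h₁ h₂) hj
  have e₁ : b ∘ Equiv.swap p q = b := funext fun j => by
    by_cases h : Equiv.swap p q j = j
    · simp [h]
    · exact hb j h
  have e₂ : flip b q ∘ Equiv.swap p q = flip b p := by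
    funext j
    have := congrFun e₁ j
    simp only [Function.comp_apply] at this
    simp only [Function.comp_apply, flip_apply, this, Equiv.swap_apply_eq_iff,
      Equiv.swap_apply_right]
  have h₁ := tr_swap hpq hp hq (d := b) fun _ _ _ => rfl
  have h₂ := tr_swap hpq hp hq (d := flip b q) fun _ _ h => flip_of_ne _ h
  rw [e₁] at h₁
  rw [e₂] at h₂
  refine square_relations (tr_mul_self _ _) (tr_mul_self _ _) ?_ h₁ h₂
    (tr_chain hpq hp hq)
  exact tc_comm (Finset.mem_univ p) (Finset.mem_univ p) hpq hpq (by simp)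

/-- The braid relation at a vertex, and the equality of the two ways around a square. -/
theorem tr_square (b : Bits n) {p q : Fin n} (hpq : p ≠ q) :
    tr b p * tr b q * tr b p = tr b q * tr b p * tr b q ∧
    tr b p * tr (flip b p) q * tr b p = tr b q * tr (flip b q) p * tr b q := by
  -- The relations are known at the corner `c` with both bits `1`; `b` is one of the four corners of
  -- its square.
  obtain ⟨c, hcp, hcq, hc⟩ : ∃ c : Bits n, c p = true ∧ c q = true ∧
      (b = c ∨ b = flip c p ∨ b = flip c q ∨ b = flip (flip c p) q) := by
    cases hp : b p <;> cases hq : b q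
    · exact ⟨flip (flip b q) p, by simp [hp, flip_of_ne _ hpq],
        by simp [hq, flip_of_ne _ hpq.symm], by simp⟩
    · exact ⟨flip b p, by simp [hp], by simp [hq, flip_of_ne _ hpq.symm], by simp⟩
    · exact ⟨flip b q, by simp [hp, flip_of_ne _ hpq], by simp [hq], by simp⟩
    · exact ⟨b, hp, hq, .inl rfl⟩
  obtain ⟨r₁, r₂, r₃, r₄, d₁, d₂⟩ := tr_square_of_true hpq hcp hcq
  have f₁ : tr (flip (flip c p) q) p = tr (flip c q) p := by rw [flip_comm, tr_flip]
  rcases hc with rfl | rfl | rfl | rfl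
  · exact ⟨r₁.symm, r₂.symm.trans d₂⟩
  · simp only [tr_flip, flip_flip, f₁]
    exact ⟨r₂.symm, r₁.symm.trans d₁⟩
  · simp only [tr_flip, flip_flip, flip_comm c q p]
    exact ⟨r₃.symm, r₄.symm.trans (d₁.symm)⟩
  · simp only [tr_flip, flip_flip, f₁, flip_comm (flip c p) q p]
    exact ⟨r₄.symm, r₃.symm.trans d₂.symm⟩

/-! ### Transpositions of arbitrary pairs of strings -/

theorem hammingDist_flip {a b : Bits n} {i : Fin n} (h : a i ≠ b i) :
    hammingDist a b = hammingDist a (flip b i) + 1 := by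
  have e : ({j | a j ≠ b j} : Finset (Fin n)) = insert i ({j | a j ≠ flip b i j} : Finset _) := by
    ext j
    by_cases hj : j = i
    · subst hj; simpa using h
    · simp [hj, flip_of_ne]
  have hn : i ∉ ({j | a j ≠ flip b i j} : Finset (Fin n)) := by
    cases ha : a i <;> cases hb : b i <;> simp_all
  unfold hammingDist
  rw [e, Finset.card_insert_of_notMem hn]

theorem eq_flip_of_hammingDist_eq_one {a b : Bits n} {i : Fin n} (h : a i ≠ b i)
    (hd : hammingDist a b = 1) : a = flip b i := by
  rw [hammingDist_flip h] at hd
  exact hammingDist_eq_zero.1 (by omega)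

theorem flip_left_injective (b : Bits n) : Function.Injective (flip b) := by
  intro i j h
  by_contra hij
  have := congrFun h i
  rw [flip_of_ne _ hij] at this
  simp at this

theorem flip_flip_ne_flip (b : Bits n) (i j k : Fin n) : flip (flip b i) j ≠ flip b k := by
  intro h
  by_cases hij : i = j
  · subst hij
    rw [flip_flip] at h
    exact flip_ne b k h.symm
  · have h₁ := congrFun h i
    have h₂ := congrFun h j
    simp only [flip_apply] at h₁ h₂
    grind

open Classical in
/-- The element exchanging `a` and the string `b` at Hamming distance `d` from `a`, as a conjugate
along a path from `b` to `a` of length `d`. -/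
noncomputable def transpositionAux (a : Bits n) : ℕ → Bits n → CircuitGroup n
  | 0, _ => 1
  | d + 1, b =>
    if h : ∃ i, a i ≠ b i then
      if d = 0 then tr b h.choose
      else tr b h.choose * transpositionAux a d (flip b h.choose) * tr b h.choose
    else 1

theorem conj_eq_conj_of_commute {G : Type*} [Group G] {u v w x S : G} (hu : u * u = 1)
    (hw : w * w = 1) (huS : Commute u S) (hwS : Commute w S) (h : u * v * u = w * x * w) :
    u * (v * S * v) * u = w * (x * S * x) * w := by
  have key : ∀ u v : G, u * u = 1 → Commute u S →
      u * (v * S * v) * u = (u * v * u) * S * (u * v * u) := by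
    intro u v hu huS
    calc u * (v * S * v) * u = u * v * (S * (u * u)) * v * u := by
          rw [hu, mul_one]; simp only [mul_assoc]
      _ = u * v * (S * u) * u * v * u := by simp only [mul_assoc]
      _ = _ := by rw [← huS.eq]; simp only [mul_assoc]
  rw [key u v hu huS, key w x hw hwS, h]

/-- Independence of the first step and commutation with disjoint edges need each other, so one
induction on distance proves both. Two first steps `k` and `i` are compared by continuing each with
the other: both reach `flip (flip b k) i`, and the square relation applies once `tr b k` and `tr b
i` commute with the inner transposition. -/
theorem transpositionAux_spec (a : Bits n) (d : ℕ) (b : Bits n) (hb : hammingDist a b = d + 1) :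
    (∀ i, a i ≠ b i → transpositionAux a (d + 1) b =
      if d = 0 then tr b i else tr b i * transpositionAux a d (flip b i) * tr b i) ∧
    ∀ c j, c ≠ a → c ≠ b → flip c j ≠ a → flip c j ≠ b →
      Commute (tr c j) (transpositionAux a (d + 1) b) := by
  induction d using Nat.strong_induction_on generalizing b with
  | _ d ih =>
  have hab : a ≠ b := by
    rintro rfl
    simp at hb
  have hex : ∃ i, a i ≠ b i := Function.ne_iff.1 hab
  have hchoice : ∀ i, a i ≠ b i → transpositionAux a (d + 1) b =
      if d = 0 then tr b i else tr b i * transpositionAux a d (flip b i) * tr b i := by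
    intro i hi
    rw [transpositionAux, dif_pos hex]
    have hk := hex.choose_spec
    generalize hex.choose = k at hk ⊢
    by_cases hki : k = i
    · rw [hki]
    have hk' := hammingDist_flip hk
    have hi' := hammingDist_flip hi
    have hki' : a i ≠ flip b k i := by rwa [flip_of_ne _ (Ne.symm hki)]
    have hik' : a k ≠ flip b i k := by rwa [flip_of_ne _ hki]
    have hk₂ := hammingDist_flip hki'
    obtain ⟨e, rfl⟩ : ∃ e, d = e + 1 := ⟨d - 1, by omega⟩
    rw [if_neg (by omega), if_neg (by omega),
      (ih e (by omega) (flip b k) (by omega)).1 i hki',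
      (ih e (by omega) (flip b i) (by omega)).1 k hik']
    have hsq := (tr_square b hki).2
    split_ifs with he
    · exact hsq
    · obtain ⟨f, rfl⟩ : ∃ f, e = f + 1 := ⟨e - 1, by omega⟩
      rw [flip_comm b i k]
      have hc := (ih f (by omega) (flip (flip b k) i) (by omega)).2
      refine conj_eq_conj_of_commute (tr_mul_self _ _) (tr_mul_self _ _) (hc _ _ hab.symm ?_ ?_ ?_)
        (hc _ _ hab.symm ?_ ?_ ?_) hsq
      · intro h
        exact absurd (congrFun h k) (by rw [flip_of_ne _ hki]; simp)
      · rintro rfl; simp at hk₂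
      · exact (flip_ne _ _).symm
      · intro h
        exact absurd (congrFun h k) (by rw [flip_of_ne _ hki]; simp)
      · rintro rfl; simp at hi'; omega
      · rw [flip_comm]; exact (flip_ne _ _).symm
  refine ⟨hchoice, fun c j hca hcb hja hjb => ?_⟩
  obtain ⟨i, hi⟩ := hex
  have hi' := hammingDist_flip hi
  rcases Nat.eq_zero_or_pos d with rfl | hd
  · rw [hchoice i hi, if_pos rfl]
    have := eq_flip_of_hammingDist_eq_one hi hb
    exact (tr_comm hcb (this ▸ hca) hjb (this ▸ hja)).symm
  · obtain ⟨e, rfl⟩ : ∃ e, d = e + 1 := ⟨d - 1, by omega⟩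
    -- At distance at least two there are two possible first steps. An edge meeting both would join
    -- two neighbours of `b`, which parity forbids; so some step avoids the edge.
    obtain ⟨k, hk, hck, hjk⟩ : ∃ k, a k ≠ b k ∧ c ≠ flip b k ∧ flip c j ≠ flip b k := by
      by_contra! hcon
      have hne : a ≠ flip b i := by
        rintro rfl
        simp at hi'
        omega
      obtain ⟨k, hk⟩ := Function.ne_iff.1 hne
      have hki : k ≠ i := by
        rintro rfl
        cases h₁ : a k <;> cases h₂ : b k <;> simp_all
      rw [flip_of_ne _ hki] at hk
      have h₁ := hcon i hi
      have h₂ := hcon k hk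
      by_cases hc : c = flip b i
      · by_cases hc' : c = flip b k
        · exact hki (flip_left_injective b (hc'.symm.trans hc))
        · have := h₂ hc'
          rw [hc] at this
          exact flip_flip_ne_flip _ _ _ _ this
      · by_cases hc' : c = flip b k
        · have := h₁ hc
          rw [hc'] at this
          exact flip_flip_ne_flip _ _ _ _ this
        · exact hki (flip_left_injective b ((h₂ hc').symm.trans (h₁ hc)))
    rw [hchoice k hk, if_neg (by omega)]
    have hk' := hammingDist_flip hk
    have h₁ : Commute (tr c j) (tr b k) := (tr_comm hcb hck hjb hjk).symm
    have h₂ := (ih e (by omega) (flip b k) (by omega)).2 c j hca hck hja hjk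
    exact (h₁.mul_right h₂).mul_right h₁

/-- The elements exchanging `a` with another string are consistently defined by conjugation along
the edges of the hypercube. -/
theorem exists_transposition (a : Bits n) : ∃ T : Bits n → CircuitGroup n,
    (∀ i, T (flip a i) = tr a i) ∧
    ∀ b i, b ≠ a → flip b i ≠ a → T (flip b i) = tr b i * T b * tr b i := by
  have key : ∀ b i, a i ≠ b i → flip b i ≠ a → transpositionAux a (hammingDist a b) b =
      tr b i * transpositionAux a (hammingDist a (flip b i)) (flip b i) * tr b i := by
    intro b i hi hb
    have h := hammingDist_flip hi
    rw [h, (transpositionAux_spec a _ b h).1 i hi, if_neg]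
    rw [hammingDist_eq_zero]
    exact hb.symm
  refine ⟨fun b => transpositionAux a (hammingDist a b) b, fun i => ?_, fun b i hba hfa => ?_⟩
  · have hi : a i ≠ flip a i i := by simp
    have h : hammingDist a (flip a i) = 0 + 1 := by rw [hammingDist_flip hi]; simp
    simp only [h, (transpositionAux_spec a _ _ h).1 i hi, if_true, tr_flip]
  -- Here the flip moves away from `a`, so the recursion is read at `flip b i`; in the other case
  -- the conjugation is inverted.
  · by_cases hi : a i = b i
    · have := key (flip b i) i (by simp [hi]) (by simpa using hba)
      rwa [flip_flip, tr_flip] at this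
    · have := key b i hi hfa
      simp only [this, ← mul_assoc, tr_mul_self, one_mul]
      simp only [mul_assoc, tr_mul_self, mul_one]

/-! ### Edge gates and generation by full gates -/

theorem edgeGate_spec {a b : Bits n} (h : (hypercube n).Adj a b) :
    ∃ k, b = flip a k ∧ edgeGate h = ctl Finset.univ a k := by
  have hk := Fintype.choose_spec (fun j => a j ≠ b j) h
  have hu : ∀ j, a j ≠ b j → j = Fintype.choose (fun j => a j ≠ b j) h :=
    fun j hj => h.unique hj hk
  have ht : (edgeGate h).target = Fintype.choose (fun j => a j ≠ b j) h := rfl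
  generalize Fintype.choose (fun j => a j ≠ b j) h = k at *
  have hb : b = flip a k := by
    funext j
    by_cases hj : j = k
    · subst hj
      cases h₁ : a j <;> cases h₂ : b j <;> simp_all
    · rw [flip_of_ne _ hj]
      by_contra hne
      exact hj (hu j (Ne.symm hne))
  refine ⟨k, hb, Gate.ext ?_ ?_ ht⟩
  · ext j
    by_cases hj : j = k <;> simp [edgeGate, ctl, hj, hb, flip_apply]
  · ext j
    by_cases hj : j = k <;> simp [edgeGate, ctl, hj, hb, flip_apply]

theorem edgeGate_apply_left {a b : Bits n} (h : (hypercube n).Adj a b) :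
    (edgeGate h).apply a = b := by
  obtain ⟨k, rfl, e⟩ := edgeGate_spec h
  rw [e, ctl_apply, if_pos fun _ _ _ => rfl]

theorem edgeGate_apply_of_ne {a b s : Bits n} (h : (hypercube n).Adj a b) (ha : s ≠ a)
    (hb : s ≠ b) : (edgeGate h).apply s = s := by
  obtain ⟨k, rfl, e⟩ := edgeGate_spec h
  rw [e, ctl_apply, if_neg]
  intro hs
  by_cases hk : s k = a k
  · refine ha (funext fun j => ?_)
    by_cases hj : j = k
    · rw [hj, hk]
    · exact hs j (Finset.mem_univ j) hj
  · refine hb (funext fun j => ?_)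
    by_cases hj : j = k
    · subst hj
      cases h₁ : a j <;> cases h₂ : s j <;> simp_all
    · rw [flip_of_ne _ hj]
      exact hs j (Finset.mem_univ j) hj

theorem tc_mem_of_tr_mem {K : Subgroup (CircuitGroup n)} (hK : ∀ b i, tr b i ∈ K)
    (S : Finset (Fin n)) (b : Bits n) (i : Fin n) : tc Sᶜ b i ∈ K := by
  induction S using Finset.induction_on generalizing b with
  | empty => simpa [tr] using hK b i
  | insert c S hc ih =>
    have hS : insert c (insert c S)ᶜ = Sᶜ := by
      ext j
      by_cases hj : j = c <;> simp [hj, hc]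
    by_cases hci : c = i
    · subst hci
      have : tc (insert c S)ᶜ b c = tc Sᶜ b c :=
        congrArg (fun A => cls [A]) (ctl_congr (by ext j; simp) fun _ _ => rfl)
      rw [this]
      exact ih b
    · rw [tc_split (c := c) (by simp) hci, hS]
      exact K.mul_mem (ih _) (ih _)

theorem cls_mem_of_tr_mem {K : Subgroup (CircuitGroup n)} (hK : ∀ b i, tr b i ∈ K)
    (C : Circuit n) : cls C ∈ K := by
  induction C with
  | nil => exact K.one_mem
  | cons A C ih =>
    rw [cls_cons]
    refine K.mul_mem ?_ ih
    rw [A.eq_ctl]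
    have := tc_mem_of_tr_mem hK (A.pos ∪ A.neg)ᶜ (fun j => decide (j ∈ A.pos)) A.target
    rwa [compl_compl] at this

/-! ### Moving a generator through a block -/

section Coxeter

variable {G : Type*} [Group G]

/-- The product `m x * m (x + 1) * ⋯ * m (x + k)`. -/
def blockProd (m : ℕ → G) (x : ℕ) : ℕ → G
  | 0 => m x
  | k + 1 => blockProd m x k * m (x + k + 1)

variable {m : ℕ → G} {L : ℕ}

theorem blockProd_mul_of_far (hcomm : ∀ i j, i + 1 < j → j < L → m i * m j = m j * m i)
    {x k j : ℕ} (hj : x + k + 1 < j) (hjL : j < L) :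
    blockProd m x k * m j = m j * blockProd m x k := by
  induction k with
  | zero => exact hcomm x j (by omega) hjL
  | succ k ih =>
    rw [blockProd, mul_assoc, hcomm _ j (by omega) hjL, ← mul_assoc, ih (by omega), mul_assoc]

theorem blockProd_mul_of_lt (hcomm : ∀ i j, i + 1 < j → j < L → m i * m j = m j * m i)
    (hbraid : ∀ i, i + 1 < L → m i * m (i + 1) * m i = m (i + 1) * m i * m (i + 1))
    {x k j : ℕ} (hx : x ≤ j) (hj : j < x + k) (hL : x + k < L) :
    blockProd m x k * m j = m (j + 1) * blockProd m x k := by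
  induction k with
  | zero => omega
  | succ k ih =>
    rcases Nat.lt_or_ge j (x + k) with h | h
    · rw [blockProd, mul_assoc, ← hcomm j _ (by omega) (by omega), ← mul_assoc,
        ih h (by omega), mul_assoc]
    · obtain rfl : j = x + k := by omega
      cases k with
      | zero => exact (hbraid x (by omega)).trans (mul_assoc _ _ _)
      | succ k =>
        have hb := hbraid (x + (k + 1)) (by omega)
        have hf : blockProd m x k * m (x + (k + 1) + 1) = m (x + (k + 1) + 1) * blockProd m x k :=
          blockProd_mul_of_far hcomm (by omega) (by omega)
        simp only [blockProd]
        calc blockProd m x k * m (x + k + 1) * m (x + (k + 1) + 1) * m (x + (k + 1))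
            = blockProd m x k *
                (m (x + (k + 1)) * m (x + (k + 1) + 1) * m (x + (k + 1))) := by
              simp only [mul_assoc, add_assoc]
          _ = (blockProd m x k * m (x + (k + 1) + 1)) * m (x + (k + 1)) *
                m (x + (k + 1) + 1) := by rw [hb]; simp only [mul_assoc]
          _ = _ := by rw [hf]; simp only [mul_assoc, add_assoc]

end Coxeter

/-! ### Coxeter relations and generation for the path gates -/

section Path

variable {u v : Bits n} (H : (hypercube n).Walk u v)

/-- The class of `M H i`, extended by `1` to all natural numbers. -/
def pathGen (i : ℕ) : CircuitGroup n := if h : i < H.length then cls [M H ⟨i, h⟩] else 1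

theorem pathGen_eq {i : ℕ} (h : i < H.length) : pathGen H i = cls [M H ⟨i, h⟩] := dif_pos h

theorem pathGen_spec {i : ℕ} (h : i < H.length) :
    ∃ k, H.getVert (i + 1) = flip (H.getVert i) k ∧ pathGen H i = tr (H.getVert i) k := by
  obtain ⟨k, h₁, h₂⟩ := edgeGate_spec (H.adj_getVert_succ h)
  exact ⟨k, h₁, by rw [pathGen_eq H h, M, h₂]; rfl⟩

theorem pathGen_mul_self (i : ℕ) : pathGen H i * pathGen H i = 1 := by
  by_cases h : i < H.length
  · rw [pathGen_eq H h, cls_mul_self]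
  · rw [pathGen, dif_neg h, mul_one]

variable {H}

theorem getVert_ne (hH : H.IsPath) {i j : ℕ} (hi : i ≤ H.length) (hj : j ≤ H.length)
    (hij : i ≠ j) : H.getVert i ≠ H.getVert j :=
  fun h => hij (hH.getVert_injOn hi hj h)

theorem pathGen_comm (hH : H.IsPath) (i j : ℕ) (hij : i + 1 < j) (hj : j < H.length) :
    pathGen H i * pathGen H j = pathGen H j * pathGen H i := by
  obtain ⟨k, hk, ek⟩ := pathGen_spec H (i := i) (by omega)
  obtain ⟨l, hl, el⟩ := pathGen_spec H hj
  rw [ek, el]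
  refine tr_comm ?_ ?_ ?_ ?_ <;> try rw [← hk]
  all_goals try rw [← hl]
  all_goals exact getVert_ne hH (by omega) (by omega) (by omega)

theorem pathGen_braid (hH : H.IsPath) (i : ℕ) (hi : i + 1 < H.length) :
    pathGen H i * pathGen H (i + 1) * pathGen H i =
      pathGen H (i + 1) * pathGen H i * pathGen H (i + 1) := by
  obtain ⟨k, hk, ek⟩ := pathGen_spec H (i := i) (by omega)
  obtain ⟨l, hl, el⟩ := pathGen_spec H hi
  have hkl : k ≠ l := by
    rintro rfl
    rw [hk, flip_flip] at hl
    exact getVert_ne hH (i := i + 1 + 1) (j := i) (by omega) (by omega) (by omega) hl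
  have e : tr (H.getVert i) k = tr (H.getVert (i + 1)) k := by rw [hk, tr_flip]
  rw [ek, el, e]
  exact (tr_square _ hkl).1

/-- Starting from the earlier endpoint of the edge on `H`, each path gate conjugates the
transposition to the next vertex. Since `H` is a path, it never returns to the start, so
`exists_transposition` applies until the other endpoint, where the element is the edge itself. -/
theorem tr_mem_closure (hH : H.IsHamiltonian) (b : Bits n) (p : Fin n) :
    tr b p ∈ Subgroup.closure {g | ∃ i < H.length, pathGen H i = g} := by
  have hp := hH.isPath
  have key : ∀ i e, i + e + 1 ≤ H.length → ∀ T : Bits n → CircuitGroup n,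
      (∀ k, T (flip (H.getVert i) k) = tr (H.getVert i) k) →
      (∀ b k, b ≠ H.getVert i → flip b k ≠ H.getVert i →
        T (flip b k) = tr b k * T b * tr b k) →
      T (H.getVert (i + e + 1)) ∈ Subgroup.closure {g | ∃ i < H.length, pathGen H i = g} := by
    intro i e he T hT₁ hT₂
    induction e with
    | zero =>
      obtain ⟨k, hk, ek⟩ := pathGen_spec H (i := i) (by omega)
      rw [add_zero, hk, hT₁, ← ek]
      exact Subgroup.subset_closure ⟨i, by omega, rfl⟩
    | succ e ih =>
      obtain ⟨k, hk, ek⟩ := pathGen_spec H (i := i + e + 1) (by omega)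
      have hm : tr (H.getVert (i + e + 1)) k ∈
          Subgroup.closure {g | ∃ i < H.length, pathGen H i = g} :=
        Subgroup.subset_closure ⟨i + e + 1, by omega, ek⟩
      rw [← add_assoc, hk, hT₂ _ _ (getVert_ne hp (by omega) (by omega) (by omega))
        (hk ▸ getVert_ne hp (by omega) (by omega) (by omega))]
      exact mul_mem (mul_mem hm (ih (by omega))) hm
  obtain ⟨i, hi, hiL⟩ := SimpleGraph.Walk.mem_support_iff_exists_getVert.1 (hH.mem_support b)
  obtain ⟨j, hj, hjL⟩ :=
    SimpleGraph.Walk.mem_support_iff_exists_getVert.1 (hH.mem_support (flip b p))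
  have hij : i ≠ j := by
    rintro rfl
    exact flip_ne b p (hj.symm.trans hi)
  rcases lt_or_gt_of_ne hij with h | h
  · obtain ⟨T, hT₁, hT₂⟩ := exists_transposition (H.getVert i)
    have := key i (j - i - 1) (by omega) T hT₁ hT₂
    rwa [show i + (j - i - 1) + 1 = j by omega, hj, ← hi, hT₁, hi] at this
  · obtain ⟨T, hT₁, hT₂⟩ := exists_transposition (H.getVert j)
    have := key j (i - j - 1) (by omega) T hT₁ hT₂
    rw [show j + (i - j - 1) + 1 = i by omega, hi] at this
    have e := hT₁ p
    rw [hj, flip_flip, tr_flip] at e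
    rwa [e] at this

/-! ### Existence of canonical forms -/

theorem Block.circuit_zero {x : ℕ} (h : x + 0 < H.length) :
    (Block.mk x 0 h : Block H).circuit = [M H ⟨x, h⟩] := by
  simp [Block.circuit]

theorem Block.circuit_succ {x k : ℕ} (h : x + (k + 1) < H.length) :
    (Block.mk x (k + 1) h : Block H).circuit =
      (Block.mk x k (by omega) : Block H).circuit ++ [M H ⟨x + k + 1, h⟩] := by
  simp only [Block.circuit]
  rw [List.ofFn_succ', List.concat_eq_append]
  rfl

theorem cls_block {x k : ℕ} (h : x + k < H.length) :
    cls (Block.mk x k h : Block H).circuit = blockProd (pathGen H) x k := by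
  induction k with
  | zero => rw [Block.circuit_zero, blockProd, pathGen_eq H (i := x) h]
  | succ k ih =>
    rw [Block.circuit_succ, cls_append, ih, blockProd, pathGen_eq H (i := x + k + 1) h]

variable (H) in
/-- `g` is the class of a circuit in canonical form whose blocks start at `x` or later. -/
def CanonicalFrom (x : ℕ) (g : CircuitGroup n) : Prop :=
  ∃ bs : List (Block H), bs.Pairwise (fun b c => c.x < b.x) ∧ (∀ b ∈ bs, x ≤ b.x) ∧
    g = cls (bs.map Block.circuit).flatten

theorem CanonicalFrom.of_succ {x : ℕ} {g : CircuitGroup n} (h : CanonicalFrom H (x + 1) g) :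
    CanonicalFrom H x g := by
  obtain ⟨bs, h₁, h₂, h₃⟩ := h
  exact ⟨bs, h₁, fun b hb => (Nat.le_succ x).trans (h₂ b hb), h₃⟩

theorem CanonicalFrom.mul_block {x k : ℕ} {g : CircuitGroup n} (h : CanonicalFrom H (x + 1) g)
    (hk : x + k < H.length) : CanonicalFrom H x (g * blockProd (pathGen H) x k) := by
  obtain ⟨bs, h₁, h₂, rfl⟩ := h
  refine ⟨bs ++ [⟨x, k, hk⟩], ?_, ?_, ?_⟩
  · rw [List.pairwise_append]
    refine ⟨h₁, List.pairwise_singleton _ _, fun b hb c hc => ?_⟩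
    rw [List.mem_singleton] at hc
    subst hc
    exact h₂ b hb
  · intro b hb
    rcases List.mem_append.1 hb with hb | hb
    · exact (Nat.le_succ x).trans (h₂ b hb)
    · rw [List.mem_singleton] at hb
      subst hb
      exact le_rfl
  · simp [cls_append, cls_block]

/-- Starting indices decrease strictly, so only the last block can start at `x`. -/
theorem CanonicalFrom.cases {x : ℕ} {g : CircuitGroup n} (h : CanonicalFrom H x g) :
    CanonicalFrom H (x + 1) g ∨ ∃ k g', x + k < H.length ∧ CanonicalFrom H (x + 1) g' ∧
      g = g' * blockProd (pathGen H) x k := by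
  obtain ⟨bs, h₁, h₂, rfl⟩ := h
  rcases List.eq_nil_or_concat bs with rfl | ⟨cs, b, rfl⟩
  · exact .inl ⟨[], .nil, by simp, rfl⟩
  rw [List.concat_eq_append] at h₁ h₂ ⊢
  rw [List.pairwise_append] at h₁
  have hcs : ∀ c ∈ cs, b.x < c.x := fun c hc => h₁.2.2 c hc b (by simp)
  have hb : x ≤ b.x := h₂ b (by simp)
  rcases hb.lt_or_eq with hlt | heq
  · refine .inl ⟨cs ++ [b], List.pairwise_append.2 h₁, fun c hc => ?_, rfl⟩
    rcases List.mem_append.1 hc with hc | hc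
    · exact hlt.trans (hcs c hc)
    · rw [List.mem_singleton] at hc
      subst hc
      exact hlt
  · obtain ⟨y, k, hk⟩ := b
    obtain rfl : x = y := heq
    exact .inr ⟨k, _, hk, ⟨cs, h₁.1, fun c hc => hcs c hc, rfl⟩, by simp [cls_append, cls_block]⟩

/-- Let the last block be `x, …, x + k`. A generator inside it passes to the left as `j + 1`, one
far beyond passes unchanged, and both are absorbed by the earlier blocks by induction. The generator
`x + k` shortens or deletes the block, and `x + k + 1` lengthens it. -/
theorem CanonicalFrom.mul_pathGen (hH : H.IsPath) (d : ℕ) :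
    ∀ {x j : ℕ} {g : CircuitGroup n}, x + d = H.length → CanonicalFrom H x g → x ≤ j →
      j < H.length → CanonicalFrom H x (g * pathGen H j) := by
  induction d with
  | zero => intro x j g hx _ hxj hj; omega
  | succ d ih =>
    intro x j g hx hg hxj hj
    rcases hg.cases with hg | ⟨k, g', hk, hg', rfl⟩
    · rcases hxj.eq_or_lt with rfl | hlt
      · exact hg.mul_block (k := 0) hj
      · exact (ih (by omega) hg hlt hj).of_succ
    · rcases lt_trichotomy j (x + k) with h | rfl | h
      · rw [mul_assoc, blockProd_mul_of_lt (pathGen_comm hH) (pathGen_braid hH) hxj h hk,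
          ← mul_assoc]
        exact (ih (by omega) hg' (by omega) (by omega)).mul_block hk
      · cases k with
        | zero =>
          rw [blockProd, add_zero, mul_assoc, pathGen_mul_self, mul_one]
          exact hg'.of_succ
        | succ k =>
          rw [blockProd, ← add_assoc, mul_assoc, mul_assoc, pathGen_mul_self, mul_one]
          exact hg'.mul_block (by omega)
      · rcases Nat.lt_or_ge (x + k + 1) j with h' | h'
        · rw [mul_assoc, blockProd_mul_of_far (pathGen_comm hH) h' hj, ← mul_assoc]
          exact (ih (by omega) hg' (by omega) hj).mul_block hk
        · obtain rfl : j = x + k + 1 := by omega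
          rw [mul_assoc]
          exact hg'.mul_block (k := k + 1) hj

theorem canonicalFrom_zero (hH : H.IsHamiltonian) (C : Circuit n) :
    CanonicalFrom H 0 (cls C) := by
  have hC := cls_mem_of_tr_mem (tr_mem_closure hH) C
  generalize cls C = g at hC ⊢
  induction hC using Subgroup.closure_induction_right with
  | one => exact ⟨[], .nil, by simp, rfl⟩
  | mul_right g hg y hy ih =>
    obtain ⟨i, hi, rfl⟩ := hy
    exact ih.mul_pathGen hH.isPath _ (Nat.zero_add _) (Nat.zero_le _) hi
  | mul_inv_cancel g hg y hy ih =>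
    obtain ⟨i, hi, rfl⟩ := hy
    rw [inv_eq_of_mul_eq_one_left (pathGen_mul_self H i)]
    exact ih.mul_pathGen hH.isPath _ (Nat.zero_add _) (Nat.zero_le _) hi

/-! ### Uniqueness of canonical forms -/

theorem run_block_start {x k : ℕ} (h : x + k < H.length) :
    run (Block.mk x k h : Block H).circuit (H.getVert x) = H.getVert (x + k + 1) := by
  induction k with
  | zero =>
    rw [Block.circuit_zero]
    exact edgeGate_apply_left (H.adj_getVert_succ h)
  | succ k ih =>
    rw [Block.circuit_succ, run_append, ih]
    exact edgeGate_apply_left (H.adj_getVert_succ h)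

theorem run_block_of_lt (hH : H.IsPath) {x k j : ℕ} (h : x + k < H.length) (hj : j < x) :
    run (Block.mk x k h : Block H).circuit (H.getVert j) = H.getVert j := by
  induction k with
  | zero =>
    rw [Block.circuit_zero]
    exact edgeGate_apply_of_ne (H.adj_getVert_succ h)
      (getVert_ne hH (by omega) (by omega) (by omega))
      (getVert_ne hH (by omega) (by omega) (by omega))
  | succ k ih =>
    rw [Block.circuit_succ, run_append, ih]
    exact edgeGate_apply_of_ne (H.adj_getVert_succ h)
      (getVert_ne hH (by omega) (by omega) (by omega))
      (getVert_ne hH (by omega) (by omega) (by omega))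

theorem run_blocks_of_lt (hH : H.IsPath) {j : ℕ} (bs : List (Block H))
    (hbs : ∀ b ∈ bs, j < b.x) :
    run (bs.map Block.circuit).flatten (H.getVert j) = H.getVert j := by
  induction bs with
  | nil => rfl
  | cons b bs ih =>
    rw [List.map_cons, List.flatten_cons, run_append,
      run_block_of_lt hH b.lt_length (hbs b (by simp))]
    exact ih fun c hc => hbs c (by simp [hc])

theorem run_blocks_append (cs : List (Block H)) (b : Block H) (s : Bits n) :
    run ((cs ++ [b]).map Block.circuit).flatten s =
      run b.circuit (run (cs.map Block.circuit).flatten s) := by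
  rw [← run_append]
  simp

theorem run_blocks_last (hH : H.IsPath) {cs : List (Block H)} {b : Block H}
    (h : (cs ++ [b]).Pairwise (fun b c => c.x < b.x)) :
    run ((cs ++ [b]).map Block.circuit).flatten (H.getVert b.x) =
      H.getVert (b.x + b.k + 1) := by
  rw [run_blocks_append, run_blocks_of_lt hH, run_block_start b.lt_length]
  exact fun c hc => (List.pairwise_append.1 h).2.2 c hc b (by simp)

theorem run_blocks_last_of_lt (hH : H.IsPath) {cs : List (Block H)} {b : Block H}
    (h : (cs ++ [b]).Pairwise (fun b c => c.x < b.x)) {j : ℕ} (hj : j < b.x) :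
    run ((cs ++ [b]).map Block.circuit).flatten (H.getVert j) = H.getVert j := by
  refine run_blocks_of_lt hH _ fun c hc => ?_
  rcases List.mem_append.1 hc with hc | hc
  · exact hj.trans ((List.pairwise_append.1 h).2.2 c hc b (by simp))
  · rw [List.mem_singleton] at hc
    rwa [hc]

/-- The last block has the smallest start `x`, and earlier blocks fix every vertex up to index `x`.
So `x` is the first moved index and its image has index `x + k + 1`; both are read off the function.
Injectivity of `run` on the common last block removes it. -/
theorem blocks_unique (hH : H.IsPath) (bs : List (Block H)) :
    ∀ bs' : List (Block H), bs.Pairwise (fun b c => c.x < b.x) →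
      bs'.Pairwise (fun b c => c.x < b.x) →
      run (bs.map Block.circuit).flatten = run (bs'.map Block.circuit).flatten → bs = bs' := by
  have hmove : ∀ b : Block H, H.getVert (b.x + b.k + 1) ≠ H.getVert b.x := fun b => by
    have := b.lt_length
    exact getVert_ne hH (by omega) (by omega) (by omega)
  induction bs using List.reverseRecOn with
  | nil =>
    intro bs' _ h' hrun
    rcases List.eq_nil_or_concat bs' with rfl | ⟨cs', b', rfl⟩
    · rfl
    · rw [List.concat_eq_append] at h' hrun
      have := run_blocks_last hH h'
      rw [← hrun] at this
      exact absurd this.symm (hmove b')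
  | append_singleton cs b ih =>
    intro bs' h h' hrun
    rcases List.eq_nil_or_concat bs' with rfl | ⟨cs', b', rfl⟩
    · have := run_blocks_last hH h
      rw [hrun] at this
      exact absurd this.symm (hmove b)
    · rw [List.concat_eq_append] at h' hrun ⊢
      have hx : b.x = b'.x := by
        rcases lt_trichotomy b.x b'.x with hlt | heq | hlt
        · have := run_blocks_last_of_lt hH h' hlt
          rw [← hrun, run_blocks_last hH h] at this
          exact absurd this (hmove b)
        · exact heq
        · have := run_blocks_last_of_lt hH h hlt
          rw [hrun, run_blocks_last hH h'] at this
          exact absurd this (hmove b')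
      have hk : b.k = b'.k := by
        have h₁ := run_blocks_last hH h
        rw [hrun, hx, run_blocks_last hH h'] at h₁
        have := b.lt_length
        have := b'.lt_length
        by_contra hne
        exact getVert_ne hH (by omega) (by omega) (by omega) h₁
      obtain rfl : b = b' := by
        cases b; cases b'
        cases hx; cases hk
        rfl
      have hcs : run (cs.map Block.circuit).flatten = run (cs'.map Block.circuit).flatten := by
        funext s
        have := congrFun hrun s
        rw [run_blocks_append, run_blocks_append] at this
        exact run_injective _ this
      rw [ih cs' (List.pairwise_append.1 h).1 (List.pairwise_append.1 h').1 hcs]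

end Path

end RevCircuit

theorem mainTheorem2 (n : ℕ) {u v : RevCircuit.Bits n}
    (H : (RevCircuit.hypercube n).Walk u v) (hH : H.IsHamiltonian) (C : RevCircuit.Circuit n) :
    ∃ D : RevCircuit.Circuit n,
      RevCircuit.IsCanonicalFormOf H C D ∧
      (∀ D' : RevCircuit.Circuit n, RevCircuit.IsCanonicalFormOf H C D' → D' = D) ∧
      RevCircuit.Transforms C D := by
  obtain ⟨bs, hbs, -, hC⟩ := RevCircuit.canonicalFrom_zero hH C
  have hCD : RevCircuit.Transforms C _ ∧ RevCircuit.Equivalent C _ := Quotient.exact hC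
  refine ⟨_, ⟨⟨bs, hbs, rfl⟩, hCD.2⟩, ?_, hCD.1⟩
  rintro D' ⟨⟨bs', hbs', rfl⟩, hD'⟩
  rw [RevCircuit.blocks_unique hH.isPath bs' bs hbs' hbs (hD'.symm.trans hCD.2)]
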